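/- Graphs are finite and simple, and $\log$ is the natural logarithm. For positive integers $n,k$, an $(n,k)$-graph is a graph whose vertex set is a disjoint union of $n$ independent sets (blobs), each of size at most $k$, with exactly one edge between any two distinct blobs. For a graph $H$ let $f(n,H)$ be the least positive integer $k$ for which there is an $(n,k)$-graph that does not contain $H$ as a (not necessarily induced) subgraph; if $H$ is not a forest, such a $k$ exists for every $n$. Let $\mathrm{ex}(\ell,H)$ be the largest number of edges of a graph on $\ell$ vertices that does not contain $H$ as a subgraph. **Theorem.** Let $H$ be a bipartite graph that is not a forest. Suppose that there are constants $C,C'>0$ and real exponents $a,b$ with $b<2$ and $$b-a<\frac{(2-b)(b-1)}{5-b}$$ such that $C\ell^a\le \mathrm{ex}(\ell,H)\le C'\ell^b$ for all sufficiently large $\ell$. Then: 1. If $\mathrm{ex}(nk,H)\ge 12n^2\log n$, then $f(n,H)\le k+o(k)$ as $n\to\infty$, uniformly in $k$. That is, for every $\varepsilon>0$ there is an $n_0$ such that for all $n\ge n_0$ and all $k$ with $\mathrm{ex}(nk,H)\ge 12n^2\log n$ one has $f(n,H)\le(1+\varepsilon)k$. 2. For all $n\ge|V(H)|$ and all $k$: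 if $\mathrm{ex}(nk,H)<\binom n2$, then $f(n,H)\ge k$. -/

import Mathlib

open Filter

/-- `G` is an `(n,k)`-graph: its vertex set is split into `n` blobs (the colour classes of a proper
colouring, so that each blob is independent), each of size at most `k`, with exactly one edge
between any two distinct blobs. -/
def IsNKGraph {V : Type*} (G : SimpleGraph V) (n k : ℕ) : Prop :=
  ∃ blob : G.Coloring (Fin n),
    (∀ i, (blob.colorClass i).encard ≤ k) ∧
    ∀ i j, i ≠ j → ∃! e : V × V, blob e.1 = i ∧ blob e.2 = j ∧ G.Adj e.1 e.2

/-- The positive integers `k` for which there is an `H`-free `(n,k)`-graph (which is finite, as it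
has at most `n * k` vertices). -/
def splitSizes {W : Type*} (n : ℕ) (H : SimpleGraph W) : Set ℕ :=
  {k | 0 < k ∧ ∃ (V : Type) (G : SimpleGraph V), IsNKGraph G n k ∧ H.Free G}

/-- `f(n,H)`, the least positive integer `k` for which there is an `H`-free `(n,k)`-graph. -/
noncomputable def splitNumber {W : Type*} (n : ℕ) (H : SimpleGraph W) : ℕ :=
  sInf (splitSizes n H)

/-- If `H` is not a forest, the minimum defining `f(n,H)` is over a nonempty set. -/
theorem splitSizes_nonempty {W : Type*} (n : ℕ) (H : SimpleGraph W) (hH : ¬ H.IsAcyclic) :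
    (splitSizes n H).Nonempty := by
  let G : SimpleGraph (Fin n × Fin n) :=
    { Adj := fun x y => x.1 ≠ x.2 ∧ y = (x.2, x.1)
      symm := ⟨by
        rintro ⟨a, b⟩ ⟨c, d⟩ ⟨h, h'⟩
        simp only [Prod.mk.injEq] at h' ⊢
        exact ⟨by rw [h'.1, h'.2]; exact fun e => h e.symm, h'.2.symm, h'.1.symm⟩⟩
      loopless := ⟨by
        rintro ⟨a, b⟩ ⟨h, h'⟩
        simp only [Prod.mk.injEq] at h'
        exact h h'.1⟩ }
  let blob : G.Coloring (Fin n) := SimpleGraph.Coloring.mk Prod.fst (by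
    rintro ⟨a, b⟩ ⟨c, d⟩ ⟨h, h'⟩
    simp only [Prod.mk.injEq] at h'
    rw [h'.1]
    exact h)
  refine ⟨n + 1, Nat.succ_pos n, Fin n × Fin n, G, ⟨blob, ?_, ?_⟩, ?_⟩
  · intro i
    have hsub : blob.colorClass i ⊆ (fun b => (i, b)) '' (Set.univ : Set (Fin n)) := by
      rintro ⟨a, b⟩ h
      exact ⟨b, trivial, by rw [show a = i from h]⟩
    refine (Set.encard_le_encard hsub).trans ((Set.encard_image_le _ _).trans ?_)
    rw [Set.encard_univ, ENat.card_eq_coe_fintype_card, Fintype.card_fin]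
    exact_mod_cast Nat.le_succ n
  · intro i j hij
    refine ⟨((i, j), (j, i)), ⟨rfl, rfl, hij, rfl⟩, ?_⟩
    rintro ⟨⟨a, b⟩, ⟨c, d⟩⟩ ⟨h1, h2, h3, h4⟩
    change a = i at h1
    change c = j at h2
    simp only [Prod.mk.injEq] at h4
    obtain ⟨h5, h6⟩ := h4
    subst h1 h2 h5 h6
    rfl
  · rintro ⟨φ⟩
    apply hH
    intro v p hp
    apply hp.snd_ne_penultimate
    have h1 := φ.toHom.map_adj (p.adj_snd hp.not_nil)
    have h2 := φ.toHom.map_adj (p.adj_penultimate hp.not_nil).symm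
    exact φ.injective (h1.2.trans h2.2.symm)

/-!
Upper bound: colour the vertices of an extremal `H`-free graph on `n * k` vertices uniformly at
random with `n` colours. Since surplus edges may be discarded, it suffices that every two colours
are joined by an edge and that every colour class has size at most `(1 + ε) * k`. A Chernoff bound
takes care of the sizes. For a pair of colours, bisect the graph along a large cut and expose the
vertices of the first colour on one side: by a Janson-type estimate, their neighbourhood on the
other side is so large that the second colour avoids it with probability `o(n⁻²)`.

That estimate needs all degrees to be at most `n / 3`, so the edges at vertices of larger degree are
deleted first. There are few of them: by `ex(ℓ, H) = O(ℓ ^ b)`, an `H`-free graph has few edges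
between a set of vertices and the rest of the graph. It is enough to treat the least admissible `k`,
for which `ex(n * (k - 1), H) < 12 * n ^ 2 * log n`; the lower bound on `ex` then makes `n` at least
a suitable power of `n * k`.

Lower bound: an `H`-free `(n, k)`-graph has at least `n.choose 2` edges and at most `n * k`
vertices, and it stays `H`-free when isolated vertices are added, because it already has at least
`|V(H)|` vertices.
-/

section RandomSubset

open Finset

variable {α β : Type*} [DecidableEq β] {p : ℝ}

theorem exp_neg_le_one_sub_add_sq {x : ℝ} (hx : 0 ≤ x) : Real.exp (-x) ≤ 1 - x + x ^ 2 / 2 := by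
  rw [Real.exp_neg, inv_le_iff_one_le_mul₀ (Real.exp_pos x)]
  nlinarith [Real.quadratic_le_exp_of_nonneg hx, sq_nonneg (x - 1), sq_nonneg (x ^ 2)]

theorem one_sub_add_mul_pow_mul_exp_le {D : ℝ} (hp : 0 ≤ p) (hp1 : p ≤ 1) (hpD : p * D ≤ 1)
    {w : ℕ} (hw : w ≤ D) :
    (1 - p) + p * ((1 - p) ^ w * Real.exp (p ^ 2 * (1 - 3 / 2 * (p * D)) * (w * D)))
      ≤ Real.exp (-(p ^ 2 * (1 - 3 / 2 * (p * D)) * w)) := by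
  set x : ℝ := p * w with hx
  have hx0 : 0 ≤ x := by positivity
  have hxD : x ≤ p * D := mul_le_mul_of_nonneg_left hw hp
  have hpow : (1 - p) ^ w ≤ Real.exp (-x) := by
    calc (1 - p) ^ w ≤ Real.exp (-p) ^ w :=
          pow_le_pow_left₀ (by linarith) (Real.one_sub_le_exp_neg p) w
      _ = Real.exp (-x) := by rw [← Real.exp_nat_mul, hx]; ring_nf
  have hexponent : p ^ 2 * (1 - 3 / 2 * (p * D)) * (w * D) ≤ x * (p * D) := by
    rw [hx]
    nlinarith [mul_nonneg hx0 (mul_self_nonneg (p * D))]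
  have hinner : (1 - p) ^ w * Real.exp (p ^ 2 * (1 - 3 / 2 * (p * D)) * (w * D))
      ≤ 1 - x * (1 - 3 / 2 * (p * D)) := by
    calc (1 - p) ^ w * Real.exp (p ^ 2 * (1 - 3 / 2 * (p * D)) * (w * D))
        ≤ Real.exp (-x) * Real.exp (x * (p * D)) := by
          gcongr
      _ = Real.exp (-(x * (1 - p * D))) := by rw [← Real.exp_add]; ring_nf
      _ ≤ 1 - x * (1 - p * D) + (x * (1 - p * D)) ^ 2 / 2 :=
          exp_neg_le_one_sub_add_sq (mul_nonneg hx0 (by linarith))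
      _ ≤ 1 - x * (1 - p * D) + (x * (p * D)) / 2 := by
          have : (x * (1 - p * D)) ^ 2 ≤ x ^ 2 := by
            gcongr
            nlinarith
          nlinarith
      _ = 1 - x * (1 - 3 / 2 * (p * D)) := by ring
  calc (1 - p) + p * ((1 - p) ^ w * Real.exp (p ^ 2 * (1 - 3 / 2 * (p * D)) * (w * D)))
      ≤ (1 - p) + p * (1 - x * (1 - 3 / 2 * (p * D))) := by gcongr
    _ = 1 - p ^ 2 * (1 - 3 / 2 * (p * D)) * w := by rw [hx]; ring
    _ ≤ _ := Real.one_sub_le_exp_neg _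

theorem sum_card_inter_sub_le (nb : α → Finset β) (s : Finset α) (R T : Finset β) {D : ℝ}
    (hR : ∀ v ∈ R, (#{u ∈ s | v ∈ nb u} : ℝ) ≤ D) :
    ∑ u ∈ s, (#(R ∩ nb u) : ℝ) - #(R ∩ T) * D ≤ ∑ u ∈ s, (#((R \ T) ∩ nb u) : ℝ) := by
  have hsplit : ∀ u : α, (#(R ∩ nb u) : ℝ) = #((R ∩ T) ∩ nb u) + #((R \ T) ∩ nb u) := fun u ↦ by
    have hsdiff : (R \ T) ∩ nb u = (R ∩ nb u) \ T := by
      ext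
      simp only [mem_inter, Finset.mem_sdiff]
      tauto
    rw [inter_right_comm, hsdiff, ← Nat.cast_add, card_inter_add_card_sdiff]
  have hswap : ∑ u ∈ s, #((R ∩ T) ∩ nb u) = ∑ v ∈ R ∩ T, #{u ∈ s | v ∈ nb u} := by
    have := sum_card_bipartiteAbove_eq_sum_card_bipartiteBelow (s := s) (t := R ∩ T)
      fun u v ↦ v ∈ nb u
    simpa only [bipartiteAbove, bipartiteBelow, filter_mem_eq_inter] using this
  have hcovered : ∑ u ∈ s, (#((R ∩ T) ∩ nb u) : ℝ) ≤ #(R ∩ T) * D := by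
    rw [← Nat.cast_sum, hswap, Nat.cast_sum, ← nsmul_eq_mul]
    exact sum_le_card_nsmul _ _ _ fun v hv ↦ hR v (mem_inter.1 hv).1
  rw [sum_congr rfl fun u _ ↦ hsplit u, sum_add_distrib]
  linarith

variable [DecidableEq α]

/-- The expectation of `f S`, where `S` is a random subset of `s` that contains each element of `s`
independently with probability `p`; written as a finite sum, so that random colourings can be
counted with it. -/
noncomputable def randomSubsetExpect (p : ℝ) (s : Finset α) (f : Finset α → ℝ) : ℝ :=
  ∑ S ∈ s.powerset, p ^ #S * (1 - p) ^ #(s \ S) * f S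

theorem randomSubsetExpect_insert {u : α} {s : Finset α} (hu : u ∉ s) (f : Finset α → ℝ) :
    randomSubsetExpect p (insert u s) f =
      (1 - p) * randomSubsetExpect p s f + p * randomSubsetExpect p s fun S ↦ f (insert u S) := by
  simp only [randomSubsetExpect, sum_powerset_insert hu, mul_sum]
  congr 1 <;> refine sum_congr rfl fun S hS ↦ ?_
  all_goals have huS : u ∉ S := fun h ↦ hu (mem_powerset.1 hS h)
  · rw [insert_sdiff_of_notMem _ huS, card_insert_of_notMem (by simp [hu])]
    ring
  · rw [insert_sdiff_insert, sdiff_insert_of_notMem hu, card_insert_of_notMem huS]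
    ring

theorem randomSubsetExpect_const_mul (s : Finset α) (c : ℝ) (f : Finset α → ℝ) :
    randomSubsetExpect p s (fun S ↦ c * f S) = c * randomSubsetExpect p s f := by
  simp only [randomSubsetExpect, mul_sum]
  exact sum_congr rfl fun S _ ↦ by ring

theorem card_inter_biUnion_insert (nb : α → Finset β) (R : Finset β) (u : α) (S : Finset α) :
    #(R ∩ (insert u S).biUnion nb) = #(R ∩ nb u) + #((R \ nb u) ∩ S.biUnion nb) := by
  rw [← card_union_of_disjoint]
  · congr 1
    ext x
    simp only [biUnion_insert, mem_inter, mem_union, Finset.mem_sdiff]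
    tauto
  · exact (disjoint_sdiff_inter R (nb u)).symm.mono le_rfl inter_subset_left

theorem randomSubsetExpect_insert_pow_card_inter_biUnion {u : α} {s : Finset α} (hu : u ∉ s)
    (nb : α → Finset β) (R : Finset β) (x : ℝ) :
    randomSubsetExpect p (insert u s) (fun S ↦ x ^ #(R ∩ S.biUnion nb))
      = (1 - p) * randomSubsetExpect p s (fun S ↦ x ^ #(R ∩ S.biUnion nb))
        + p * (x ^ #(R ∩ nb u)
          * randomSubsetExpect p s fun S ↦ x ^ #((R \ nb u) ∩ S.biUnion nb)) := by
  simp only [randomSubsetExpect_insert hu, card_inter_biUnion_insert, pow_add,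
    randomSubsetExpect_const_mul]

theorem randomSubsetExpect_pow_card_inter_biUnion_le (nb : α → Finset β) {D : ℝ}
    (hp : 0 ≤ p) (hp1 : p ≤ 1) (hpD : p * D ≤ 2 / 3) (s : Finset α)
    (hs : ∀ u ∈ s, (#(nb u) : ℝ) ≤ D) (R : Finset β)
    (hR : ∀ v ∈ R, (#{u ∈ s | v ∈ nb u} : ℝ) ≤ D) :
    randomSubsetExpect p s (fun S ↦ (1 - p) ^ #(R ∩ S.biUnion nb))
      ≤ Real.exp (-(p ^ 2 * (1 - 3 / 2 * (p * D)) * ∑ u ∈ s, (#(R ∩ nb u) : ℝ))) := by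
  set c : ℝ := p ^ 2 * (1 - 3 / 2 * (p * D))
  induction s using Finset.induction_on generalizing R with
  | empty => simp [randomSubsetExpect]
  | insert u s hu ih =>
    have hsD : ∀ x ∈ s, (#(nb x) : ℝ) ≤ D := fun x hx ↦ hs x (mem_insert_of_mem hx)
    have hRD : ∀ v ∈ R, (#{x ∈ s | v ∈ nb x} : ℝ) ≤ D := fun v hv ↦
      (Nat.cast_le.2 (card_le_card (filter_subset_filter _ (subset_insert u s)))).trans (hR v hv)
    set w : ℕ := #(R ∩ nb u)
    set E : ℝ := ∑ x ∈ s, (#(R ∩ nb x) : ℝ)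
    have hwD : (w : ℝ) ≤ D :=
      (Nat.cast_le.2 (card_le_card inter_subset_right)).trans (hs u (mem_insert_self _ _))
    have hrest : randomSubsetExpect p s (fun S ↦ (1 - p) ^ #((R \ nb u) ∩ S.biUnion nb))
        ≤ Real.exp (-(c * (E - w * D))) := by
      refine (ih hsD _ fun v hv ↦ hRD v (Finset.mem_sdiff.1 hv).1).trans (Real.exp_le_exp.2 ?_)
      have hc0 : 0 ≤ c := mul_nonneg (sq_nonneg p) (by linarith)
      gcongr
      exact sum_card_inter_sub_le nb s R (nb u) hRD
    have : 0 ≤ 1 - p := sub_nonneg.2 hp1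
    rw [randomSubsetExpect_insert_pow_card_inter_biUnion hu, sum_insert hu]
    calc _ ≤ (1 - p) * Real.exp (-(c * E))
          + p * ((1 - p) ^ w * Real.exp (-(c * (E - w * D)))) := by
          gcongr
          exact ih hsD R hRD
      _ = Real.exp (-(c * E)) * ((1 - p) + p * ((1 - p) ^ w * Real.exp (c * (w * D)))) := by
          rw [show -(c * (E - w * D)) = -(c * E) + c * (w * D) by ring, Real.exp_add]
          ring
      _ ≤ Real.exp (-(c * E)) * Real.exp (-(c * w)) := by
          gcongr
          exact one_sub_add_mul_pow_mul_exp_le hp hp1 (by linarith) hwD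
      _ = Real.exp (-(c * (w + E))) := by
          rw [← Real.exp_add]
          ring_nf

end RandomSubset

section RandomColoring

open Finset

variable {V ι : Type*} [Fintype V] [DecidableEq V]

theorem card_interedges_eq_sum (G : SimpleGraph V) [DecidableRel G.Adj] (S T : Finset V) :
    #(G.interedges S T) = ∑ u ∈ S, #(T ∩ G.neighborFinset u) := by
  rw [SimpleGraph.interedges_def, card_filter, sum_product]
  refine sum_congr rfl fun u _ ↦ ?_
  rw [← card_filter, ← filter_mem_eq_inter]
  simp only [SimpleGraph.mem_neighborFinset]

theorem four_mul_card_filter_mem_and_notMem {u v : V} (huv : u ≠ v) :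
    4 * #{A : Finset V | u ∈ A ∧ v ∉ A} = 2 ^ Fintype.card V := by
  have hIcc : ({A : Finset V | u ∈ A ∧ v ∉ A} : Finset (Finset V)) = Icc {u} {v}ᶜ := by
    ext A
    simp [subset_compl_comm (t := {v})]
  have hcard : #{u, v} ≤ Fintype.card V := card_le_univ _
  rw [card_pair huv] at hcard
  rw [hIcc, card_Icc_finset (by simpa using huv.symm), card_compl, card_singleton, card_singleton,
    Nat.sub_sub, show 4 = 2 ^ 2 from rfl, ← pow_add, Nat.add_sub_cancel' hcard]

-- Average over all cuts: each edge is cut by half of them.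
theorem exists_card_edgeFinset_le_two_mul_card_interedges_compl (G : SimpleGraph V)
    [DecidableRel G.Adj] :
    ∃ A : Finset V, #G.edgeFinset ≤ 2 * #(G.interedges A Aᶜ) := by
  have hsum : ∑ A : Finset V, #(G.interedges A Aᶜ)
      = ∑ e : V × V with G.Adj e.1 e.2, #{A : Finset V | e.1 ∈ A ∧ e.2 ∉ A} := by
    have := sum_card_bipartiteAbove_eq_sum_card_bipartiteBelow (s := (univ : Finset (Finset V)))
      (t := ({e : V × V | G.Adj e.1 e.2} : Finset (V × V))) fun A e ↦ e.1 ∈ A ∧ e.2 ∉ A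
    simp only [bipartiteAbove, bipartiteBelow] at this
    rw [← this]
    refine sum_congr rfl fun A _ ↦ congrArg card ?_
    ext e
    simp only [SimpleGraph.mem_interedges_iff, mem_compl, mem_filter, mem_univ, true_and]
    tauto
  have hcut : 4 * ∑ A : Finset V, #(G.interedges A Aᶜ)
      = 2 * #G.edgeFinset * 2 ^ Fintype.card V := by
    rw [hsum, mul_sum, sum_congr rfl fun e he ↦
      four_mul_card_filter_mem_and_notMem (mem_filter.1 he).2.ne, sum_const, smul_eq_mul,
      SimpleGraph.two_mul_card_edgeFinset]
  obtain ⟨A, -, hA⟩ := exists_le_of_sum_le (s := (univ : Finset (Finset V))) univ_nonempty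
    (f := fun _ ↦ #G.edgeFinset) (g := fun A ↦ 2 * #(G.interedges A Aᶜ)) (by
      rw [sum_const, card_univ, Fintype.card_finset, smul_eq_mul, ← mul_sum]
      linarith)
  exact ⟨A, hA⟩

variable [Fintype ι] [DecidableEq ι]

theorem card_colorings_with_trace {A S T : Finset V} (hS : S ⊆ A) (hT : Disjoint A T) (i j : ι) :
    (#{φ : V → ι | ({u ∈ A | φ u = i} : Finset V) = S ∧ ∀ v ∈ T, φ v ≠ j} : ℝ)
      = Fintype.card ι ^ Fintype.card V * ((1 / Fintype.card ι) ^ #S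
        * (1 - 1 / Fintype.card ι) ^ #(A \ S) * (1 - 1 / Fintype.card ι) ^ #T) := by
  set q : ℝ := ↑(Fintype.card ι) with hq
  have hq0 : q ≠ 0 := Nat.cast_ne_zero.2 (Fintype.card_pos_iff.2 ⟨i⟩).ne'
  have hcompl : ∀ c : ι, (#({c}ᶜ : Finset ι) : ℝ) = q * (1 - 1 / q) := fun c ↦ by
    rw [card_compl, card_singleton, Nat.cast_sub (Fintype.card_pos_iff.2 ⟨i⟩)]
    field_simp
    simp [hq]
  clear_value q
  let box : V → Finset ι := fun v ↦
    if v ∈ S then {i} else if v ∈ A \ S then {i}ᶜ else if v ∈ T then {j}ᶜ else univ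
  have hbox : ({φ : V → ι | ({u ∈ A | φ u = i} : Finset V) = S ∧ ∀ v ∈ T, φ v ≠ j} : Finset _)
      = Fintype.piFinset box := by
    ext φ
    simp only [mem_filter, mem_univ, true_and, Fintype.mem_piFinset, box, Finset.ext_iff,
      ← forall_and]
    refine forall_congr' fun v ↦ ?_
    have hSA : v ∈ S → v ∈ A := fun h ↦ hS h
    have hAT : v ∈ A → v ∉ T := fun h ↦ disjoint_left.1 hT h
    split_ifs with h₁ h₂ h₃ <;> simp_all
  have hcard : ∀ v, (#(box v) : ℝ) = q * ((if v ∈ S then 1 / q else 1)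
      * (if v ∈ A \ S then 1 - 1 / q else 1) * (if v ∈ T then 1 - 1 / q else 1)) := fun v ↦ by
    have hSA : v ∈ S → v ∈ A := fun h ↦ hS h
    have hAT : v ∈ A → v ∉ T := fun h ↦ disjoint_left.1 hT h
    by_cases h₁ : v ∈ S <;> by_cases h₂ : v ∈ A <;> by_cases h₃ : v ∈ T <;>
      simp_all [box]
  rw [hbox, Fintype.card_piFinset, Nat.cast_prod, prod_congr rfl fun v _ ↦ hcard v]
  simp only [prod_mul_distrib, prod_ite_mem, univ_inter, prod_const, card_univ]

theorem card_colorings_not_joined_with_trace_le (G : SimpleGraph V) [DecidableRel G.Adj]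
    {A S : Finset V} (hS : S ⊆ A) (i j : ι) :
    (#{φ : V → ι | (∀ u ∈ A, ∀ v ∉ A, G.Adj u v → φ u = i → φ v ≠ j)
        ∧ ({u ∈ A | φ u = i} : Finset V) = S} : ℝ)
      ≤ Fintype.card ι ^ Fintype.card V * ((1 / Fintype.card ι) ^ #S
        * (1 - 1 / Fintype.card ι) ^ #(A \ S)
        * (1 - 1 / Fintype.card ι) ^ #(Aᶜ ∩ S.biUnion fun u ↦ G.neighborFinset u)) := by
  rw [← card_colorings_with_trace hS (disjoint_compl_right.mono_right inter_subset_left) i j]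
  refine Nat.cast_le.2 (card_le_card fun φ hφ ↦ ?_)
  obtain ⟨hunjoined, rfl⟩ := (mem_filter_univ _).1 hφ
  refine (mem_filter_univ _).2 ⟨rfl, fun v hv ↦ ?_⟩
  obtain ⟨hvA, u, hu, huv⟩ := by simpa only [mem_inter, mem_compl, mem_biUnion] using hv
  obtain ⟨huA, hui⟩ := mem_filter.1 hu
  exact hunjoined u huA v hvA ((G.mem_neighborFinset u v).1 huv) hui

theorem card_colorings_not_joined_le (G : SimpleGraph V) [DecidableRel G.Adj] {D : ℝ}
    (hdeg : ∀ u, (G.degree u : ℝ) ≤ D) (hD : D ≤ 2 / 3 * Fintype.card ι) (A : Finset V) (i j : ι) :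
    (#{φ : V → ι | ∀ u ∈ A, ∀ v ∉ A, G.Adj u v → φ u = i → φ v ≠ j} : ℝ)
      ≤ Fintype.card ι ^ Fintype.card V * Real.exp
        (-((1 - 3 / 2 * (D / Fintype.card ι)) * #(G.interedges A Aᶜ) / Fintype.card ι ^ 2)) := by
  set q : ℝ := ↑(Fintype.card ι)
  have hq1 : 1 ≤ q := Nat.one_le_cast.2 (Fintype.card_pos_iff.2 ⟨i⟩)
  have hq0 : 0 < q := one_pos.trans_le hq1
  let nb : V → Finset V := fun u ↦ G.neighborFinset u
  set B : Finset (V → ι) := {φ | ∀ u ∈ A, ∀ v ∉ A, G.Adj u v → φ u = i → φ v ≠ j} with hB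
  have hfiber : ∀ S ∈ A.powerset, (#{φ ∈ B | ({u ∈ A | φ u = i} : Finset V) = S} : ℝ)
      ≤ q ^ Fintype.card V
        * ((1 / q) ^ #S * (1 - 1 / q) ^ #(A \ S) * (1 - 1 / q) ^ #(Aᶜ ∩ S.biUnion nb)) :=
    fun S hS ↦ by
      rw [hB, filter_filter]
      exact card_colorings_not_joined_with_trace_le G (mem_powerset.1 hS) i j
  have hjanson := randomSubsetExpect_pow_card_inter_biUnion_le nb (p := 1 / q) (D := D)
    (by positivity) (div_le_one_of_le₀ hq1 hq0.le)
    (by rwa [one_div_mul_eq_div, div_le_iff₀ hq0])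
    A (fun u _ ↦ hdeg u) Aᶜ fun v _ ↦ (Nat.cast_le.2 (card_le_card fun u hu ↦
      (G.mem_neighborFinset v u).2 ((G.mem_neighborFinset u v).1 (mem_filter.1 hu).2).symm)).trans
      (hdeg v)
  calc (#B : ℝ) = ∑ S ∈ A.powerset, (#{φ ∈ B | ({u ∈ A | φ u = i} : Finset V) = S} : ℝ) := by
        exact_mod_cast card_eq_sum_card_fiberwise fun φ _ ↦ mem_powerset.2 (filter_subset _ A)
    _ ≤ q ^ Fintype.card V
        * randomSubsetExpect (1 / q) A fun S ↦ (1 - 1 / q) ^ #(Aᶜ ∩ S.biUnion nb) := by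
      rw [randomSubsetExpect, mul_sum]
      exact sum_le_sum hfiber
    _ ≤ _ := by
      refine mul_le_mul_of_nonneg_left (hjanson.trans_eq ?_) (by positivity)
      rw [← Nat.cast_sum, ← card_interedges_eq_sum]
      congr 2
      ring

theorem sum_exp_mul_card_colorClass (t : ℝ) (i : ι) :
    ∑ φ : V → ι, Real.exp (t * #{v | φ v = i})
      = (Fintype.card ι - 1 + Real.exp t) ^ Fintype.card V := by
  have hprod : ∀ φ : V → ι, Real.exp (t * #{v | φ v = i})
      = ∏ v, (if φ v = i then Real.exp t else 1) := fun φ ↦ by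
    rw [prod_ite, prod_const, prod_const, one_pow, mul_one, mul_comm, Real.exp_nat_mul]
  have hsum : ∑ c : ι, (if c = i then Real.exp t else 1) = Fintype.card ι - 1 + Real.exp t := by
    rw [Fintype.sum_eq_add_sum_compl i, if_pos rfl, sum_congr rfl fun c hc ↦
      if_neg (by simpa using hc), sum_const, card_compl, card_singleton, nsmul_one,
      Nat.cast_sub (Fintype.card_pos_iff.2 ⟨i⟩), Nat.cast_one, add_comm]
  rw [sum_congr rfl fun φ _ ↦ hprod φ,
    ← Fintype.prod_sum fun (_ : V) (c : ι) ↦ if c = i then Real.exp t else (1 : ℝ), prod_const,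
    hsum, card_univ]

theorem sum_exp_mul_card_colorClass_le {t : ℝ} (ht : 0 ≤ t) (ht1 : t ≤ 1) (i : ι) :
    ∑ φ : V → ι, Real.exp (t * #{v | φ v = i}) ≤ Fintype.card ι ^ Fintype.card V
      * Real.exp ((t + t ^ 2) * (Fintype.card V / Fintype.card ι)) := by
  rw [sum_exp_mul_card_colorClass]
  set q : ℝ := ↑(Fintype.card ι)
  have hq0 : 0 < q := Nat.cast_pos.2 (Fintype.card_pos_iff.2 ⟨i⟩)
  have hexp : Real.exp t - 1 ≤ t + t ^ 2 := by
    have := (abs_le.1 (Real.abs_exp_sub_one_sub_id_le (x := t) (by rwa [abs_of_nonneg ht]))).2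
    linarith
  calc (q - 1 + Real.exp t) ^ Fintype.card V
      ≤ (q * Real.exp ((t + t ^ 2) / q)) ^ Fintype.card V := by
        have hbase : 0 ≤ q - 1 + Real.exp t := by linarith [Real.add_one_le_exp t]
        gcongr
        calc q - 1 + Real.exp t ≤ q * ((t + t ^ 2) / q + 1) := by
              rw [mul_add, mul_div_cancel₀ _ hq0.ne']
              linarith
          _ ≤ _ := by
              gcongr
              exact Real.add_one_le_exp _
    _ = q ^ Fintype.card V * Real.exp ((t + t ^ 2) * (Fintype.card V / q)) := by
        rw [mul_pow, ← Real.exp_nat_mul]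
        ring_nf

theorem card_colorings_large_colorClass_le {ε : ℝ} (hε : 0 ≤ ε) (hε1 : ε ≤ 1) (i : ι) :
    (#{φ : V → ι | (1 + ε) * (Fintype.card V / Fintype.card ι) < (#{v | φ v = i} : ℝ)} : ℝ)
      ≤ Fintype.card ι ^ Fintype.card V
        * Real.exp (-(ε ^ 2 / 4 * (Fintype.card V / Fintype.card ι))) := by
  set m : ℝ := Fintype.card V / Fintype.card ι
  set B : Finset (V → ι) := {φ | (1 + ε) * m < (#{v | φ v = i} : ℝ)}
  have hmarkov : #B * Real.exp (ε / 2 * ((1 + ε) * m))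
      ≤ ∑ φ : V → ι, Real.exp (ε / 2 * #{v | φ v = i}) := by
    rw [← nsmul_eq_mul]
    refine (card_nsmul_le_sum B _ _ fun φ hφ ↦ Real.exp_le_exp.2 ?_).trans
      (sum_le_univ_sum_of_nonneg fun φ ↦ (Real.exp_pos _).le)
    exact mul_le_mul_of_nonneg_left ((mem_filter_univ _).1 hφ).le (by linarith)
  have hmgf := hmarkov.trans
    (sum_exp_mul_card_colorClass_le (t := ε / 2) (by linarith) (by linarith) i)
  rw [← le_div_iff₀ (Real.exp_pos _), mul_div_assoc, ← Real.exp_sub] at hmgf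
  refine hmgf.trans_eq ?_
  congr 2
  ring

theorem exists_cut_card_colorings_not_joined_le (G : SimpleGraph V) [DecidableRel G.Adj] {D : ℝ}
    (hdeg : ∀ u, (G.degree u : ℝ) ≤ D) (hD : D ≤ 2 / 3 * Fintype.card ι) :
    ∃ A : Finset V, ∀ i j : ι,
      (#{φ : V → ι | ∀ u ∈ A, ∀ v ∉ A, G.Adj u v → φ u = i → φ v ≠ j} : ℝ)
        ≤ Fintype.card ι ^ Fintype.card V * Real.exp
          (-((1 - 3 / 2 * (D / Fintype.card ι)) * (#G.edgeFinset / 2) / Fintype.card ι ^ 2)) := by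
  obtain ⟨A, hA⟩ := exists_card_edgeFinset_le_two_mul_card_interedges_compl G
  refine ⟨A, fun i j ↦ (card_colorings_not_joined_le G hdeg hD A i j).trans ?_⟩
  have hcut : (#G.edgeFinset / 2 : ℝ) ≤ #(G.interedges A Aᶜ) := by
    rw [div_le_iff₀' two_pos]
    exact_mod_cast hA
  have hcoeff : 0 ≤ 1 - 3 / 2 * (D / Fintype.card ι) := by
    have := (div_le_iff₀ (Nat.cast_pos.2 (Fintype.card_pos_iff.2 ⟨i⟩))).2 hD
    linarith
  gcongr

omit [DecidableEq V] in
theorem exists_coloring_joined_of_lt_one [Nonempty ι] (G : SimpleGraph V) [DecidableRel G.Adj]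
    {D ε : ℝ} (hε : 0 ≤ ε) (hε1 : ε ≤ 1) (hdeg : ∀ u, (G.degree u : ℝ) ≤ D)
    (hD : D ≤ 2 / 3 * Fintype.card ι)
    (hlt : Fintype.card ι ^ 2 * Real.exp
        (-((1 - 3 / 2 * (D / Fintype.card ι)) * (#G.edgeFinset / 2) / Fintype.card ι ^ 2))
      + Fintype.card ι * Real.exp (-(ε ^ 2 / 4 * (Fintype.card V / Fintype.card ι))) < 1) :
    ∃ φ : V → ι, (∀ i, (#{v | φ v = i} : ℝ) ≤ (1 + ε) * (Fintype.card V / Fintype.card ι)) ∧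
      ∀ i j, ∃ u v, φ u = i ∧ φ v = j ∧ G.Adj u v := by
  classical
  obtain ⟨A, hA⟩ := exists_cut_card_colorings_not_joined_le G hdeg hD
  let unjoined : ι × ι → Finset (V → ι) := fun ij ↦
    {φ | ∀ u ∈ A, ∀ v ∉ A, G.Adj u v → φ u = ij.1 → φ v ≠ ij.2}
  let large : ι → Finset (V → ι) := fun i ↦
    {φ | (1 + ε) * (Fintype.card V / Fintype.card ι) < (#{v | φ v = i} : ℝ)}
  set x := Real.exp
    (-((1 - 3 / 2 * (D / Fintype.card ι)) * (#G.edgeFinset / 2) / Fintype.card ι ^ 2))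
  set y := Real.exp (-(ε ^ 2 / 4 * (Fintype.card V / Fintype.card ι)))
  have hq : (0 : ℝ) < Fintype.card ι := Nat.cast_pos.2 Fintype.card_pos
  have hbad : #(univ.biUnion unjoined ∪ univ.biUnion large) < #(univ : Finset (V → ι)) := by
    rw [← Nat.cast_lt (α := ℝ), card_univ, Fintype.card_fun, Nat.cast_pow]
    calc _ ≤ ∑ ij, (#(unjoined ij) : ℝ) + ∑ i, (#(large i) : ℝ) := by
          exact_mod_cast (card_union_le _ _).trans (add_le_add card_biUnion_le card_biUnion_le)
      _ ≤ ∑ _ij : ι × ι, Fintype.card ι ^ Fintype.card V * x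
          + ∑ _i : ι, Fintype.card ι ^ Fintype.card V * y :=
        add_le_add (sum_le_sum fun ij _ ↦ hA ij.1 ij.2)
          (sum_le_sum fun i _ ↦ card_colorings_large_colorClass_le hε hε1 i)
      _ = Fintype.card ι ^ Fintype.card V * (Fintype.card ι ^ 2 * x + Fintype.card ι * y) := by
        simp only [sum_const, card_univ, Fintype.card_prod, nsmul_eq_mul, Nat.cast_mul]
        ring
      _ < _ := mul_lt_of_lt_one_right (pow_pos hq _) hlt
  obtain ⟨φ, -, hφ⟩ := exists_mem_notMem_of_card_lt_card hbad
  simp only [mem_union, mem_biUnion, mem_univ, true_and, not_or, not_exists] at hφ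
  refine ⟨φ, fun i ↦ not_lt.1 fun h ↦ hφ.2 i ((mem_filter_univ _).2 h), fun i j ↦ ?_⟩
  by_contra! h
  exact hφ.1 (i, j) ((mem_filter_univ _).2 fun u _ v _ huv hu hv ↦ h u v hu hv huv)

end RandomColoring

section DegreeSums

open Finset

variable {V W : Type*} {H : SimpleGraph W} {G : SimpleGraph V} [DecidableRel G.Adj]

theorem card_interedges_self_le_of_free (hG : H.Free G) (X : Finset V) :
    #(G.interedges X X) ≤ 2 * SimpleGraph.extremalNumber #X H := by
  let f : X ↪ V := Function.Embedding.subtype (· ∈ X)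
  have hfree : H.Free (G.comap f) := fun h ↦
    hG (h.trans ⟨(SimpleGraph.Embedding.comap f G).toCopy⟩)
  have hedges := SimpleGraph.card_edgeFinset_le_extremalNumber hfree
  rw [Fintype.card_coe] at hedges
  calc #(G.interedges X X) ≤ #{e : X × X | (G.comap f).Adj e.1 e.2} := by
        refine card_le_card_of_surjOn (Prod.map f f) fun e he ↦ ?_
        obtain ⟨h₁, h₂, hadj⟩ := (SimpleGraph.mem_interedges_iff G).1 he
        exact ⟨(⟨e.1, h₁⟩, ⟨e.2, h₂⟩), by simpa [f] using hadj, rfl⟩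
    _ = 2 * #(G.comap f).edgeFinset := (SimpleGraph.two_mul_card_edgeFinset _).symm
    _ ≤ _ := by gcongr

theorem card_interedges_le_of_free [DecidableEq V] (hG : H.Free G) (S T : Finset V) :
    #(G.interedges S T) ≤ 2 * SimpleGraph.extremalNumber #(S ∪ T) H :=
  (card_le_card (SimpleGraph.interedges_mono G subset_union_left subset_union_right)).trans
    (card_interedges_self_le_of_free hG (S ∪ T))

theorem exists_finpartition_card_parts_mul_le [DecidableEq V] {s : Finset V} {t : ℕ} (ht : 0 < t)
    (hts : t ≤ #s) :
    ∃ P : Finpartition s, #P.parts * t ≤ #s ∧ ∀ p ∈ P.parts, #p ≤ 2 * t := by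
  have hm : 0 < #s / t := Nat.div_pos hts ht
  obtain ⟨P, hP, hcard⟩ := Finpartition.exists_equipartition_card_eq s hm.ne' (Nat.div_le_self _ _)
  refine ⟨P, by rw [hcard]; exact Nat.div_mul_le_self _ _, fun p hp ↦ ?_⟩
  have hlt : #s / (#s / t) < 2 * t := by
    rw [Nat.div_lt_iff_lt_mul hm]
    calc #s < (#s / t + 1) * t := (Nat.div_lt_iff_lt_mul ht).1 (Nat.lt_succ_self _)
      _ ≤ 2 * t * (#s / t) := by nlinarith
  have := hP.card_part_le_average_add_one hp
  rw [hcard] at this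
  omega

variable {M b : ℝ}

theorem card_interedges_le_mul_rpow_of_free (hG : H.Free G) (hM : 0 ≤ M) (hb0 : 0 ≤ b) (hb : b ≤ 2)
    (hex : ∀ l : ℕ, (SimpleGraph.extremalNumber l H : ℝ) ≤ M * (l : ℝ) ^ b) {S T : Finset V}
    (hT : #T ≤ 2 * #S) : (#(G.interedges S T) : ℝ) ≤ 18 * M * (#S : ℝ) ^ b := by
  classical
  have hunion : #(S ∪ T) ≤ 3 * #S := (card_union_le _ _).trans (by linarith)
  have h3b : (3 : ℝ) ^ b ≤ 9 := by
    calc (3 : ℝ) ^ b ≤ 3 ^ (2 : ℝ) := Real.rpow_le_rpow_of_exponent_le (by norm_num) hb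
      _ = 9 := by norm_num
  calc (#(G.interedges S T) : ℝ) ≤ 2 * SimpleGraph.extremalNumber #(S ∪ T) H := by
        exact_mod_cast card_interedges_le_of_free hG S T
    _ ≤ 2 * (M * (3 * #S : ℝ) ^ b) := by
        gcongr
        refine (hex _).trans ?_
        gcongr
        exact_mod_cast hunion
    _ = 2 * M * (#S : ℝ) ^ b * 3 ^ b := by
        rw [Real.mul_rpow (by norm_num) (Nat.cast_nonneg _)]
        ring
    _ ≤ 2 * M * (#S : ℝ) ^ b * 9 := by gcongr
    _ = _ := by ring

variable [Fintype V]

-- Cutting the vertex set into pieces of size comparable to `#S` keeps every union `S ∪ P` of size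
-- `O(#S)`, where the extremal number is small.
theorem sum_degree_le_of_free (hG : H.Free G) (hM : 0 ≤ M) (hb0 : 0 ≤ b) (hb : b ≤ 2)
    (hex : ∀ l : ℕ, (SimpleGraph.extremalNumber l H : ℝ) ≤ M * (l : ℝ) ^ b) (S : Finset V) :
    ∑ u ∈ S, (G.degree u : ℝ) ≤ 18 * M * Fintype.card V * (#S : ℝ) ^ (b - 1) := by
  classical
  rcases S.eq_empty_or_nonempty with rfl | hS
  · rw [sum_empty]
    positivity
  have hs : (0 : ℝ) < #S := Nat.cast_pos.2 hS.card_pos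
  obtain ⟨P, hparts, hsize⟩ := exists_finpartition_card_parts_mul_le hS.card_pos (card_le_univ S)
  have hpiece : ∀ p ∈ P.parts, (#(G.interedges S p) : ℝ) ≤ 18 * M * (#S : ℝ) ^ b := fun p hp ↦
    card_interedges_le_mul_rpow_of_free hG hM hb0 hb hex (hsize p hp)
  calc ∑ u ∈ S, (G.degree u : ℝ) = #(G.interedges S univ) := by
        simp only [card_interedges_eq_sum, univ_inter, Nat.cast_sum,
          SimpleGraph.card_neighborFinset_eq_degree]
    _ = ∑ p ∈ P.parts, (#(G.interedges S p) : ℝ) := by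
        exact_mod_cast Rel.card_interedges_finpartition_right G.Adj S P
    _ ≤ #P.parts * (18 * M * (#S : ℝ) ^ b) := by
        rw [← nsmul_eq_mul]
        exact sum_le_card_nsmul _ _ _ hpiece
    _ = #P.parts * #S * (18 * M * (#S : ℝ) ^ (b - 1)) := by
        rw [Real.rpow_sub_one hs.ne']
        field_simp
    _ ≤ Fintype.card V * (18 * M * (#S : ℝ) ^ (b - 1)) := by
        gcongr
        exact_mod_cast hparts
    _ = _ := by ring

theorem sum_degree_of_lt_degree_le_of_free (hG : H.Free G) (hM : 0 ≤ M) (hb1 : 1 < b) (hb : b < 2)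
    (hex : ∀ l : ℕ, (SimpleGraph.extremalNumber l H : ℝ) ≤ M * (l : ℝ) ^ b) {D : ℝ} (hD : 0 < D) :
    ∑ u with D < G.degree u, (G.degree u : ℝ) ≤ 18 * M * Fintype.card V
      * (18 * M * Fintype.card V / D) ^ ((b - 1) / (2 - b)) := by
  set S : Finset V := {u | D < G.degree u}
  have hsum := sum_degree_le_of_free hG hM (by linarith) hb.le hex S
  refine hsum.trans ?_
  rcases S.eq_empty_or_nonempty with h | h
  · rw [h, card_empty, Nat.cast_zero, Real.zero_rpow (by linarith), mul_zero]
    positivity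
  have hs : (0 : ℝ) < #S := Nat.cast_pos.2 h.card_pos
  have hcard : (#S : ℝ) ^ (2 - b) ≤ 18 * M * Fintype.card V / D := by
    rw [le_div_iff₀ hD, show 2 - b = 1 - (b - 1) by ring, Real.rpow_sub hs, Real.rpow_one,
      div_mul_eq_mul_div, div_le_iff₀ (by positivity)]
    refine le_trans ?_ hsum
    rw [← nsmul_eq_mul]
    exact card_nsmul_le_sum _ _ _ fun u hu ↦ (mem_filter.1 hu).2.le
  gcongr
  calc (#S : ℝ) ^ (b - 1) = ((#S : ℝ) ^ (2 - b)) ^ ((b - 1) / (2 - b)) := by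
        rw [← Real.rpow_mul hs.le, mul_div_cancel₀ _ (by linarith)]
    _ ≤ _ := Real.rpow_le_rpow (by positivity) hcard
        (div_nonneg (by linarith) (by linarith))

end DegreeSums

section LowDegreePart

open Finset

variable {V : Type*}

/-- The graph obtained from `G` by deleting every edge at a vertex of degree more than `D`, which
makes `D` a bound on all degrees. The vertices themselves are kept, so as not to change their
number. -/
def lowDegreePart (G : SimpleGraph V) [G.LocallyFinite] (D : ℝ) : SimpleGraph V where
  Adj u v := G.Adj u v ∧ G.degree u ≤ D ∧ G.degree v ≤ D
  symm := ⟨fun _ _ h ↦ ⟨h.1.symm, h.2.2, h.2.1⟩⟩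
  loopless := ⟨fun _ h ↦ h.1.ne rfl⟩

theorem lowDegreePart_le (G : SimpleGraph V) [G.LocallyFinite] (D : ℝ) : lowDegreePart G D ≤ G :=
  fun _ _ h ↦ h.1

variable [Fintype V] (G : SimpleGraph V) [DecidableRel G.Adj]

theorem degree_lowDegreePart_le {D : ℝ} (hD : 0 ≤ D) [DecidableRel (lowDegreePart G D).Adj]
    (u : V) : ((lowDegreePart G D).degree u : ℝ) ≤ D := by
  by_cases hu : (G.degree u : ℝ) ≤ D
  · exact (Nat.cast_le.2 (SimpleGraph.degree_le_of_le (lowDegreePart_le G D))).trans hu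
  · have : (lowDegreePart G D).degree u = 0 :=
      (SimpleGraph.degree_eq_zero_iff_notMem_support _ _).2 fun ⟨v, hv⟩ ↦ hu hv.2.1
    rwa [this, Nat.cast_zero]

theorem card_edgeFinset_le_card_lowDegreePart_add (D : ℝ)
    [DecidableRel (lowDegreePart G D).Adj] :
    #G.edgeFinset ≤ #(lowDegreePart G D).edgeFinset + ∑ u with D < G.degree u, G.degree u := by
  classical
  have hcover : G.edgeFinset ⊆ (lowDegreePart G D).edgeFinset
      ∪ ({u | D < G.degree u} : Finset V).biUnion (G.incidenceFinset ·) := by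
    intro e he
    induction e with
    | _ u v =>
      have huv : G.Adj u v := by simpa using he
      rcases le_or_gt (G.degree u : ℝ) D with hu | hu
      · rcases le_or_gt (G.degree v : ℝ) D with hv | hv
        · exact mem_union_left _ (by simpa using ⟨huv, hu, hv⟩)
        · exact mem_union_right _ (mem_biUnion.2
            ⟨v, by simpa using hv, by simpa [SimpleGraph.incidenceSet] using huv⟩)
      · exact mem_union_right _ (mem_biUnion.2
          ⟨u, by simpa using hu, by simpa [SimpleGraph.incidenceSet] using huv⟩)
  calc _ ≤ _ := card_le_card hcover
    _ ≤ _ := card_union_le _ _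
    _ ≤ _ := by
      gcongr
      refine card_biUnion_le.trans_eq (sum_congr rfl fun u _ ↦ ?_)
      rw [SimpleGraph.card_incidenceFinset_eq_degree]

end LowDegreePart

section NKGraph

open Finset

theorem exists_isNKGraph_le {V : Type*} {G : SimpleGraph V} {n k : ℕ} (φ : V → Fin n)
    (hsize : ∀ i, {v | φ v = i}.encard ≤ k)
    (hjoin : ∀ i j, i ≠ j → ∃ u v, φ u = i ∧ φ v = j ∧ G.Adj u v) :
    ∃ G' ≤ G, IsNKGraph G' n k := by
  have hedge : ∀ e : {e : Sym2 (Fin n) // ¬ e.IsDiag}, ∃ d ∈ G.edgeSet, d.map φ = e := by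
    rintro ⟨⟨i, j⟩, hij⟩
    obtain ⟨u, v, rfl, rfl, huv⟩ := hjoin i j hij
    exact ⟨s(u, v), huv, rfl⟩
  choose f hfG hfφ using hedge
  let G' : SimpleGraph V := .fromEdgeSet (Set.range f)
  have hadj : ∀ {u v}, G'.Adj u v → ∃ e, f e = s(u, v) ∧ s(φ u, φ v) = (e : Sym2 (Fin n)) := by
    intro u v huv
    obtain ⟨⟨e, he⟩, -⟩ := (SimpleGraph.fromEdgeSet_adj _).1 huv
    exact ⟨e, he, by rw [← hfφ, he, Sym2.map_mk]⟩
  have hG' : G' ≤ G := fun u v huv ↦ by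
    obtain ⟨e, he, -⟩ := hadj huv
    exact (SimpleGraph.mem_edgeSet G).1 (he ▸ hfG e)
  refine ⟨G', hG', .mk φ fun {u v} huv h ↦ ?_, hsize, fun i j hij ↦ ?_⟩
  · obtain ⟨e, -, he⟩ := hadj huv
    exact e.2 (he ▸ Sym2.mk_isDiag_iff.2 h)
  · obtain ⟨u, v, huv, hui, hvj⟩ : ∃ u v, f ⟨s(i, j), hij⟩ = s(u, v) ∧ φ u = i ∧ φ v = j := by
      have hmap := hfφ ⟨s(i, j), hij⟩
      generalize f ⟨s(i, j), hij⟩ = d at hmap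
      induction d with
      | _ u v =>
        obtain ⟨hu, hv⟩ | ⟨hu, hv⟩ := Sym2.eq_iff.1 hmap
        exacts [⟨u, v, rfl, hu, hv⟩, ⟨v, u, Sym2.eq_swap, hv, hu⟩]
    refine ⟨(u, v), ⟨hui, hvj, (SimpleGraph.fromEdgeSet_adj _).2 ⟨⟨_, huv⟩, ?_⟩⟩, ?_⟩
    · exact fun h ↦ hij (hui.symm.trans ((congrArg φ h).trans hvj))
    · rintro ⟨u', v'⟩ ⟨rfl, rfl, huv'⟩
      obtain ⟨e, he, he'⟩ := hadj huv'
      obtain rfl : e = ⟨s(φ u', φ v'), hij⟩ := Subtype.ext he'.symm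
      obtain ⟨rfl, rfl⟩ | ⟨rfl, rfl⟩ := Sym2.eq_iff.1 (he.symm.trans huv)
      exacts [rfl, absurd hvj hij]

theorem splitNumber_le_of_free {V : Type} {W : Type*} {H : SimpleGraph W} {G : SimpleGraph V}
    (hG : H.Free G) {n k : ℕ} (hk : 0 < k) (φ : V → Fin n) (hsize : ∀ i, {v | φ v = i}.encard ≤ k)
    (hjoin : ∀ i j, i ≠ j → ∃ u v, φ u = i ∧ φ v = j ∧ G.Adj u v) : splitNumber n H ≤ k := by
  obtain ⟨G', hle, hG'⟩ := exists_isNKGraph_le φ hsize hjoin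
  exact Nat.sInf_le ⟨hk, V, G', hG', fun h ↦ hG (h.trans (.of_le hle))⟩

theorem splitNumber_le_of_degree_le {V : Type} [Fintype V] {W : Type*} {H : SimpleGraph W}
    {G : SimpleGraph V} [DecidableRel G.Adj] (hG : H.Free G) {n : ℕ}
    (hn : 0 < n) (hnV : n ≤ Fintype.card V) {D ε : ℝ} (hε : 0 ≤ ε) (hε1 : ε ≤ 1)
    (hdeg : ∀ u, (G.degree u : ℝ) ≤ D) (hD : D ≤ 2 / 3 * n)
    (hlt : n ^ 2 * Real.exp (-((1 - 3 / 2 * (D / n)) * (#G.edgeFinset / 2) / n ^ 2))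
      + n * Real.exp (-(ε ^ 2 / 4 * (Fintype.card V / n))) < 1) :
    (splitNumber n H : ℝ) ≤ (1 + ε) * (Fintype.card V / n) := by
  have := Fin.pos_iff_nonempty.1 hn
  obtain ⟨φ, hsize, hjoin⟩ := exists_coloring_joined_of_lt_one (ι := Fin n) G hε hε1 hdeg
    (by rwa [Fintype.card_fin]) (by simpa only [Fintype.card_fin] using hlt)
  rw [Fintype.card_fin] at hsize
  set m : ℝ := (1 + ε) * (Fintype.card V / n)
  have hm1 : 1 ≤ m := by
    have : (1 : ℝ) ≤ Fintype.card V / n := by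
      rw [one_le_div (Nat.cast_pos.2 hn)]
      exact_mod_cast hnV
    nlinarith
  have hfloor : splitNumber n H ≤ ⌊m⌋₊ := by
    refine splitNumber_le_of_free hG (Nat.floor_pos.2 hm1) φ (fun i ↦ ?_) fun i j _ ↦ hjoin i j
    rw [← coe_filter_univ, Set.encard_coe_eq_coe_finsetCard, Nat.cast_le]
    exact Nat.le_floor (hsize i)
  exact (Nat.cast_le.2 hfloor).trans (Nat.floor_le (by linarith))

theorem pos_of_log_natCast_pos {n : ℕ} (h : 0 < Real.log n) : 0 < n :=
  Nat.pos_of_ne_zero fun hn ↦ by simp [hn] at h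

theorem sq_mul_exp_neg_mul_log_lt_half {n : ℕ} (hn : 2 ≤ Real.log n) :
    (n : ℝ) ^ 2 * Real.exp (-(11 / 4 * Real.log n)) < 1 / 2 := by
  have hn0 : (0 : ℝ) < n := Nat.cast_pos.2 (pos_of_log_natCast_pos (two_pos.trans_le hn))
  calc (n : ℝ) ^ 2 * Real.exp (-(11 / 4 * Real.log n)) = Real.exp (-(3 / 4 * Real.log n)) := by
        rw [← Real.exp_log (pow_pos hn0 2), ← Real.exp_add, Real.log_pow]
        push_cast
        ring_nf
    _ ≤ Real.exp (-1) := by gcongr; linarith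
    _ < 1 / 2 := by
        rw [Real.exp_neg, ← one_div]
        exact one_div_lt_one_div_of_lt two_pos (by linarith [Real.exp_one_gt_d9])

theorem splitNumber_le_of_le_extremalNumber {W : Type*} {H : SimpleGraph W} (hH : H ≠ ⊥)
    {M b : ℝ} (hM : 0 ≤ M) (hb1 : 1 < b) (hb : b < 2)
    (hex : ∀ l : ℕ, (SimpleGraph.extremalNumber l H : ℝ) ≤ M * (l : ℝ) ^ b)
    {n k : ℕ} (hn : 2 ≤ Real.log n) (hk : 0 < k) {ε : ℝ} (hε : 0 ≤ ε) (hε1 : ε ≤ 1)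
    (hchernoff : n * Real.exp (-(ε ^ 2 / 4 * k)) < 1 / 2)
    (hmany : 12 * (n : ℝ) ^ 2 * Real.log n ≤ SimpleGraph.extremalNumber (n * k) H)
    (hlarge : 18 * M * (n * k) * (18 * M * (n * k) / (n / 3)) ^ ((b - 1) / (2 - b))
      ≤ SimpleGraph.extremalNumber (n * k) H / 12) :
    (splitNumber n H : ℝ) ≤ (1 + ε) * k := by
  classical
  have hn0 : 0 < n := pos_of_log_natCast_pos (two_pos.trans_le hn)
  have hn0' : (0 : ℝ) < n := Nat.cast_pos.2 hn0
  obtain ⟨G, _, hGext⟩ := SimpleGraph.exists_isExtremal_free (V := Fin (n * k)) hH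
  have hedges := SimpleGraph.card_edgeFinset_of_isExtremal_free hGext
  rw [Fintype.card_fin] at hedges
  have hbig : (#G.edgeFinset : ℝ) ≤ #(lowDegreePart G (n / 3)).edgeFinset
      + SimpleGraph.extremalNumber (n * k) H / 12 := by
    have hmass := sum_degree_of_lt_degree_le_of_free hGext.1 hM hb1 hb hex
      (D := n / 3) (by positivity)
    rw [Fintype.card_fin, Nat.cast_mul] at hmass
    calc (#G.edgeFinset : ℝ) ≤ #(lowDegreePart G (n / 3)).edgeFinset
          + ∑ u with (n / 3 : ℝ) < G.degree u, (G.degree u : ℝ) := by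
          exact_mod_cast card_edgeFinset_le_card_lowDegreePart_add G (n / 3)
      _ ≤ _ := by linarith
  have hunjoined : (n : ℝ) ^ 2 * Real.exp (-((1 - 3 / 2 * (n / 3 / n))
      * (#(lowDegreePart G (n / 3)).edgeFinset / 2) / n ^ 2)) < 1 / 2 := by
    refine lt_of_le_of_lt ?_ (sq_mul_exp_neg_mul_log_lt_half hn)
    gcongr
    rw [hedges] at hbig
    rw [div_div_cancel_left' hn0'.ne', le_div_iff₀ (by positivity)]
    linarith
  have hcard : (Fintype.card (Fin (n * k)) : ℝ) / n = k := by
    rw [Fintype.card_fin, Nat.cast_mul, mul_div_cancel_left₀ _ hn0'.ne']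
  rw [← hcard] at hchernoff ⊢
  exact splitNumber_le_of_degree_le (D := n / 3)
    (fun h ↦ hGext.1 (h.trans (.of_le (lowDegreePart_le G _)))) hn0
    (by simpa using Nat.le_mul_of_pos_right n hk) hε hε1
    (degree_lowDegreePart_le G (by positivity)) (by linarith) (by linarith)

namespace IsNKGraph

variable {V : Type*} {G : SimpleGraph V} {n k : ℕ}

theorem finite (h : IsNKGraph G n k) : Finite V := by
  obtain ⟨blob, hsize, -⟩ := h
  exact Set.finite_univ_iff.1 <|
    Set.finite_univ.preimage' (f := blob) fun i _ ↦ Set.finite_of_encard_le_coe (hsize i)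

theorem card_le [Fintype V] (h : IsNKGraph G n k) : Fintype.card V ≤ n * k := by
  classical
  obtain ⟨blob, hsize, -⟩ := h
  have hfiber : ∀ i ∈ univ, #{v | blob v = i} ≤ k := fun i _ ↦ by
    rw [← Nat.cast_le (α := ℕ∞), ← Set.encard_coe_eq_coe_finsetCard, coe_filter_univ]
    exact hsize i
  simpa [mul_comm] using card_le_mul_card_image_of_maps_to (fun v _ ↦ mem_univ (blob v)) k hfiber

theorem le_card [Fintype V] (h : IsNKGraph G n k) (hn : 2 ≤ n) : n ≤ Fintype.card V := by
  obtain ⟨blob, -, hedge⟩ := h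
  have : Nontrivial (Fin n) := Fin.nontrivial_iff_two_le.2 hn
  have hsurj : Function.Surjective blob := fun i ↦ by
    obtain ⟨j, hj⟩ := exists_ne i
    obtain ⟨e, he, -⟩ := hedge i j hj.symm
    exact ⟨e.1, he.1⟩
  simpa using Fintype.card_le_of_surjective _ hsurj

theorem choose_two_le_card_edgeFinset [Fintype G.edgeSet] (h : IsNKGraph G n k) :
    n.choose 2 ≤ #G.edgeFinset := by
  obtain ⟨blob, -, hedge⟩ := h
  have htop := SimpleGraph.card_edgeFinset_top_eq_card_choose_two (V := Fin n)
  rw [Fintype.card_fin] at htop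
  rw [← htop]
  refine card_le_card_of_surjOn (Sym2.map blob) fun e he ↦ ?_
  induction e with
  | _ i j =>
    obtain ⟨⟨u, v⟩, ⟨hu, hv, huv⟩, -⟩ := hedge i j (by simpa using he)
    exact ⟨s(u, v), by simpa using huv, by simp_all⟩

end IsNKGraph

theorem exists_embedding_eqOn_of_card_le {α β : Type*} [Fintype α] [Fintype β]
    (hcard : Fintype.card α ≤ Fintype.card β) {s : Finset α} {f : α → β} (hf : Set.InjOn f s) :
    ∃ e : α ↪ β, Set.EqOn e f s := by
  classical
  obtain ⟨t, hst, ht⟩ := exists_superset_card_eq (s := s.image f) (n := Fintype.card α)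
    (card_image_le.trans (card_le_univ s)) hcard
  obtain ⟨e, he⟩ := exists_equiv_extend_of_card_eq ht.symm hst hf
  exact ⟨e.toEmbedding.trans (.subtype _), he⟩

theorem isContained_of_isContained_map {W V V' : Type*} [Fintype W] [Fintype V]
    {H : SimpleGraph W} {G : SimpleGraph V} (f : V ↪ V')
    (hcard : Fintype.card W ≤ Fintype.card V) (h : H.IsContained (G.map f)) : H.IsContained G := by
  classical
  obtain ⟨c⟩ := h
  rcases isEmpty_or_nonempty W with _ | _
  · exact .of_isEmpty
  have : Nonempty V := Fintype.card_pos_iff.1 (Fintype.card_pos.trans_le hcard)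
  let s : Finset W := {w | ∃ v, f v = c w}
  have hpre : ∀ w ∈ s, ∃ v, f v = c w := fun w hw ↦ (mem_filter.1 hw).2
  choose! g hg using hpre
  have hg_inj : Set.InjOn g s := fun w hw w' hw' h ↦
    c.injective ((hg w hw).symm.trans ((congrArg f h).trans (hg w' hw')))
  obtain ⟨e, he⟩ := exists_embedding_eqOn_of_card_le hcard hg_inj
  refine ⟨⟨⟨e, fun {w w'} hww' ↦ ?_⟩, e.injective⟩⟩
  obtain ⟨u, v, huv, hu, hv⟩ := (SimpleGraph.map_adj _ _ _ _).1 (c.toHom.map_adj hww')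
  have hw : w ∈ s := mem_filter.2 ⟨mem_univ _, u, hu⟩
  have hw' : w' ∈ s := mem_filter.2 ⟨mem_univ _, v, hv⟩
  rwa [he hw, he hw', f.injective ((hg w hw).trans hu.symm),
    f.injective ((hg w' hw').trans hv.symm)]

theorem card_edgeFinset_le_extremalNumber_of_card_le {W V : Type*} [Fintype W] [Fintype V]
    {H : SimpleGraph W} {G : SimpleGraph V} [Fintype G.edgeSet] (hG : H.Free G) {m : ℕ}
    (hWV : Fintype.card W ≤ Fintype.card V) (hVm : Fintype.card V ≤ m) :
    #G.edgeFinset ≤ SimpleGraph.extremalNumber m H := by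
  classical
  obtain ⟨f⟩ : Nonempty (V ↪ Fin m) := Function.Embedding.nonempty_of_card_le (by simpa using hVm)
  have hmap := SimpleGraph.card_edgeFinset_le_extremalNumber
    fun h ↦ hG (isContained_of_isContained_map f hWV h)
  rw [SimpleGraph.card_edgeFinset_map, Fintype.card_fin] at hmap
  convert hmap

theorem choose_two_le_extremalNumber_of_mem_splitSizes {W : Type*} [Fintype W] {H : SimpleGraph W}
    {n k l : ℕ} (hW : Fintype.card W ≤ n) (hk : k ∈ splitSizes n H) (hkl : k ≤ l) :
    n.choose 2 ≤ SimpleGraph.extremalNumber (n * l) H := by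
  classical
  obtain ⟨-, V, G, hG, hfree⟩ := hk
  rcases Nat.lt_or_ge n 2 with hn | hn
  · simp only [Nat.choose_eq_zero_of_lt hn, zero_le]
  have := hG.finite
  have := Fintype.ofFinite V
  exact hG.choose_two_le_card_edgeFinset.trans (card_edgeFinset_le_extremalNumber_of_card_le hfree
    (hW.trans (hG.le_card hn)) (hG.card_le.trans (Nat.mul_le_mul_left n hkl)))

theorem le_splitNumber {W : Type*} [Fintype W] {H : SimpleGraph W} (hH : ¬ H.IsAcyclic) {n k : ℕ}
    (hW : Fintype.card W ≤ n) (hlt : SimpleGraph.extremalNumber (n * k) H < n.choose 2) :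
    k ≤ splitNumber n H := by
  by_contra! hk
  have hmem : splitNumber n H ∈ splitSizes n H := Nat.sInf_mem (splitSizes_nonempty n H hH)
  exact hlt.not_ge (choose_two_le_extremalNumber_of_mem_splitSizes hW hmem hk.le)

end NKGraph

section Asymptotics

theorem eventually_mul_rpow_le_mul_rpow {a a' K c : ℝ} (hc : 0 < c) (ha : a' < a) :
    ∀ᶠ x : ℝ in atTop, K * x ^ a' ≤ c * x ^ a := by
  filter_upwards [(tendsto_rpow_atTop (sub_pos.2 ha)).eventually_ge_atTop (K / c),
    eventually_gt_atTop 0] with x hx hx0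
  rw [div_le_iff₀ hc, Real.rpow_sub hx0, div_mul_eq_mul_div, le_div_iff₀ (by positivity)] at hx
  linarith

theorem exponent_le_of_eventually {a b C C' : ℝ} (hC : 0 < C)
    (h : ∀ᶠ l : ℕ in atTop, C * (l : ℝ) ^ a ≤ C' * (l : ℝ) ^ b) : a ≤ b := by
  by_contra! hab
  obtain ⟨l, hl, hl', hl0⟩ := (h.and <| (tendsto_natCast_atTop_atTop.eventually
    (eventually_mul_rpow_le_mul_rpow (K := C' + 1) hC hab)).and (eventually_gt_atTop 0)).exists
  have : 0 < (l : ℝ) ^ b := Real.rpow_pos_of_pos (Nat.cast_pos.2 hl0) b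
  linarith

theorem exists_forall_le_mul_rpow {F : ℕ → ℝ} (hF : ∀ l, 0 ≤ F l) (hF0 : F 0 = 0) {b C : ℝ}
    (hb : 0 < b) (hC : 0 < C) (h : ∀ᶠ l : ℕ in atTop, F l ≤ C * (l : ℝ) ^ b) :
    ∃ M, 0 < M ∧ ∀ l : ℕ, F l ≤ M * (l : ℝ) ^ b := by
  obtain ⟨l₀, hl₀⟩ := eventually_atTop.1 h
  have hsum : 0 ≤ ∑ i ∈ Finset.range l₀, F i := Finset.sum_nonneg fun i _ ↦ hF i
  refine ⟨C + ∑ i ∈ Finset.range l₀, F i, by linarith, fun l ↦ ?_⟩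
  rcases Nat.eq_zero_or_pos l with rfl | hl
  · simp [hF0, Real.zero_rpow hb.ne']
  rcases le_or_gt l₀ l with hge | hlt
  · refine (hl₀ l hge).trans ?_
    gcongr
    linarith
  · have hle : F l ≤ ∑ i ∈ Finset.range l₀, F i :=
      Finset.single_le_sum (fun i _ ↦ hF i) (Finset.mem_range.2 hlt)
    have hone : (1 : ℝ) ≤ (l : ℝ) ^ b := Real.one_le_rpow (by exact_mod_cast hl) hb.le
    nlinarith

theorem mul_rpow_le_of_sq_le_mul_rpow {b M n k : ℝ} (hb : 0 < b) (hM : 0 < M) (hn : 0 < n)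
    (hk : 0 ≤ k) (h : n ^ 2 ≤ M * (n * k) ^ b) : M⁻¹ ^ (1 / b) * n ^ (2 / b - 1) ≤ k := by
  have hroot : (M⁻¹ * n ^ 2) ^ (1 / b) ≤ n * k := by
    rw [one_div, Real.rpow_inv_le_iff_of_pos (by positivity) (by positivity) hb]
    rwa [inv_mul_le_iff₀ hM]
  refine le_of_mul_le_mul_left (le_of_eq_of_le ?_ hroot) hn
  rw [Real.mul_rpow (by positivity) (by positivity), ← Real.rpow_natCast, ← Real.rpow_mul hn.le,
    Real.rpow_sub_one hn.ne', Nat.cast_ofNat, mul_one_div]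
  field_simp

theorem tendsto_mul_exp_neg_mul_rpow {c η : ℝ} (hc : 0 < c) (hη : 0 < η) :
    Tendsto (fun x : ℝ ↦ x * Real.exp (-(c * x ^ η))) atTop (nhds 0) := by
  refine ((tendsto_rpow_mul_exp_neg_mul_atTop_nhds_zero (1 / η) c hc).comp
    (tendsto_rpow_atTop hη)).congr' ?_
  filter_upwards [eventually_ge_atTop 0] with x hx
  rw [Function.comp_apply, ← Real.rpow_mul hx, mul_one_div_cancel hη.ne', Real.rpow_one, neg_mul]

theorem eventually_le_and_mul_exp_neg_mul_lt_half {b M c : ℝ} (hb0 : 0 < b) (hb : b < 2)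
    (hM : 0 < M) (hc : 0 < c) (K : ℝ) :
    ∀ᶠ n : ℝ in atTop, ∀ k, 0 ≤ k → n ^ 2 ≤ M * (n * k) ^ b →
      K ≤ k ∧ n * Real.exp (-(c * k)) < 1 / 2 := by
  have hη : 0 < 2 / b - 1 := by rw [sub_pos, lt_div_iff₀ hb0]; linarith
  have hM' : 0 < M⁻¹ ^ (1 / b) := by positivity
  filter_upwards [eventually_gt_atTop 0,
    ((tendsto_rpow_atTop hη).const_mul_atTop hM').eventually_ge_atTop K,
    (tendsto_mul_exp_neg_mul_rpow (mul_pos hc hM') hη).eventually_lt_const one_half_pos]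
    with n hn hK hexp k hk h
  have hle := mul_rpow_le_of_sq_le_mul_rpow hb0 hM hn hk h
  refine ⟨hK.trans hle, lt_of_le_of_lt ?_ hexp⟩
  rw [mul_assoc]
  gcongr

theorem eventually_rpow_le_of_rpow_le_mul_log {a θ : ℝ} (hθ : 0 < θ) (hθa : 2 * θ < a) (K : ℝ) :
    ∀ᶠ n : ℝ in atTop, ∀ x, 0 ≤ x → x ^ a ≤ K * (n ^ 2 * Real.log n) → x ^ θ ≤ n := by
  have ha : 0 < a := by linarith
  have hr : 0 < a / θ - 2 := by rw [sub_pos, lt_div_iff₀ hθ]; exact hθa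
  have hlog := (isLittleO_log_rpow_atTop hr).const_mul_left K
  filter_upwards [hlog.bound one_pos, eventually_gt_atTop 0] with n hn hn0 x hx h
  rw [one_mul, Real.norm_of_nonneg (Real.rpow_nonneg hn0.le _)] at hn
  have hxa : x ^ a ≤ n ^ (a / θ) :=
    calc x ^ a ≤ K * Real.log n * n ^ 2 := by linarith
      _ ≤ n ^ (a / θ - 2) * n ^ 2 := by gcongr; exact (le_abs_self _).trans hn
      _ = n ^ (a / θ) := by rw [← Real.rpow_natCast, ← Real.rpow_add hn0]; norm_num
  calc x ^ θ = (x ^ a) ^ (θ / a) := by rw [← Real.rpow_mul hx, mul_div_cancel₀ _ ha.ne']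
    _ ≤ (n ^ (a / θ)) ^ (θ / a) := by gcongr
    _ = n := by
        rw [← Real.rpow_mul hn0.le, div_mul_div_cancel₀ hθ.ne', div_self ha.ne', Real.rpow_one]

theorem mul_div_rpow_le_rpow {θ ρ x n : ℝ} (hρ : 0 ≤ ρ) (hx : 0 < x) (hn : 0 < n)
    (h : x ^ θ ≤ n) : x * (x / n) ^ ρ ≤ x ^ (1 + (1 - θ) * ρ) := by
  have hdiv : x / n ≤ x ^ (1 - θ) := by
    rw [Real.rpow_sub hx, Real.rpow_one]
    gcongr
  calc x * (x / n) ^ ρ ≤ x * (x ^ (1 - θ)) ^ ρ := by gcongr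
    _ = x ^ (1 + (1 - θ) * ρ) := by rw [← Real.rpow_mul hx.le, Real.rpow_add hx, Real.rpow_one]

theorem two_div_three_sub_lt {a b : ℝ} (hle : a ≤ b) (hb : b < 2)
    (hab : b - a < (2 - b) * (b - 1) / (5 - b)) : 2 / (3 - b) < a := by
  have hb1 : 1 < b := by
    have hpos : 0 < (2 - b) * (b - 1) / (5 - b) := by linarith
    have hnum := (div_pos_iff_of_pos_right (by linarith)).1 hpos
    linarith [(mul_pos_iff_of_pos_left (by linarith)).1 hnum]
  rw [lt_div_iff₀ (by linarith)] at hab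
  rw [div_lt_iff₀ (by linarith)]
  nlinarith [mul_pos (sub_pos.2 hb1) (sub_pos.2 hb)]

theorem one_lt_of_two_div_three_sub_lt {a b : ℝ} (hle : a ≤ b) (hb : b < 2)
    (ha : 2 / (3 - b) < a) : 1 < b := by
  have := (div_lt_iff₀ (by linarith)).1 (ha.trans_le hle)
  nlinarith

theorem rpow_le_of_le_two_mul {a C N m y : ℝ} (ha : 0 ≤ a) (hC : 0 < C) (hN : 0 ≤ N) (hm : 0 ≤ m)
    (hNm : N ≤ 2 * m) (hy : C * m ^ a ≤ y) : N ^ a ≤ 2 ^ a * y / C := by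
  calc N ^ a ≤ (2 * m) ^ a := by gcongr
    _ = 2 ^ a * (C * m ^ a) / C := by
        rw [Real.mul_rpow two_pos.le hm]
        field_simp
    _ ≤ 2 ^ a * y / C := by gcongr

theorem eventually_mul_mul_div_rpow_le {F : ℕ → ℝ} {a b C K L A : ℝ} (hC : 0 < C) (hK : 0 ≤ K)
    (hL : 0 ≤ L) (hb1 : 1 < b) (hb : b < 2) (ha : 2 / (3 - b) < a)
    (hlow : ∀ᶠ l : ℕ in atTop, C * (l : ℝ) ^ a ≤ F l) :
    ∀ᶠ n : ℕ in atTop, ∀ m N : ℕ, n ≤ m → n ≤ N → N ≤ 2 * m → F m ≤ A * (n ^ 2 * Real.log n) →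
      K * N * (L * (N / n)) ^ ((b - 1) / (2 - b)) ≤ F N := by
  set θ : ℝ := 1 / (3 - b) with hθ
  set ρ : ℝ := (b - 1) / (2 - b) with hρ
  have h2b : 2 - b ≠ 0 := by linarith
  have h3b : 0 < 3 - b := by linarith
  have hθ0 : 0 < θ := by positivity
  have hθa : 2 * θ < a := by rwa [hθ, mul_one_div]
  have hρ0 : 0 ≤ ρ := div_nonneg (by linarith) (by linarith)
  -- The two ways in which `N ^ a` has to win, against `n ^ 2` and against the sum of the large
  -- degrees, balance exactly at this value of `θ`.
  have hbalance : 1 + (1 - θ) * ρ = 2 * θ := by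
    rw [hθ, hρ]
    field_simp
    ring
  filter_upwards [eventually_gt_atTop 0, eventually_forall_ge_atTop.2 hlow,
    tendsto_natCast_atTop_atTop.eventually
      (eventually_rpow_le_of_rpow_le_mul_log hθ0 hθa (2 ^ a * A / C)),
    eventually_forall_ge_atTop.2 (tendsto_natCast_atTop_atTop.eventually
      (eventually_mul_rpow_le_mul_rpow (K := K * L ^ ρ) hC hθa))]
    with n hn hlow hNθ hdom m N hnm hnN hNm hF
  have hn' : (0 : ℝ) < n := Nat.cast_pos.2 hn
  have hN0 : (0 : ℝ) < N := Nat.cast_pos.2 (hn.trans_le hnN)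
  have hNa : (N : ℝ) ^ a ≤ 2 ^ a * A / C * (n ^ 2 * Real.log n) :=
    (rpow_le_of_le_two_mul (by linarith) hC N.cast_nonneg m.cast_nonneg (by exact_mod_cast hNm)
      ((hlow m hnm).trans hF)).trans_eq (by ring)
  calc K * N * (L * (N / n)) ^ ρ = K * L ^ ρ * (N * (N / n) ^ ρ) := by
        rw [Real.mul_rpow hL (by positivity)]
        ring
    _ ≤ K * L ^ ρ * (N : ℝ) ^ (2 * θ) := by
        gcongr
        exact hbalance ▸ mul_div_rpow_le_rpow hρ0 hN0 hn' (hNθ N hN0.le hNa)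
    _ ≤ C * (N : ℝ) ^ a := hdom N hnN
    _ ≤ F N := hlow N hnN

end Asymptotics

theorem extremalNumber_zero {W : Type*} (H : SimpleGraph W) :
    SimpleGraph.extremalNumber 0 H = 0 := by
  have h := (SimpleGraph.extremalNumber_le_iff (V := Fin 0) H 0).2 fun G _ _ ↦ by
    simp [Subsingleton.elim G ⊥]
  simpa using h

theorem eventually_splitNumber_le_of_lt_of_le {W : Type*} {H : SimpleGraph W} (hH : H ≠ ⊥)
    {a b C M ε : ℝ} (hC : 0 < C) (hM : 0 < M) (hb1 : 1 < b) (hb : b < 2) (ha : 2 / (3 - b) < a)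
    (hlow : ∀ᶠ l : ℕ in atTop, C * (l : ℝ) ^ a ≤ SimpleGraph.extremalNumber l H)
    (hup : ∀ l : ℕ, (SimpleGraph.extremalNumber l H : ℝ) ≤ M * (l : ℝ) ^ b)
    (hε : 0 < ε) (hε1 : ε ≤ 1) :
    ∀ᶠ n : ℕ in atTop, ∀ k : ℕ,
      (SimpleGraph.extremalNumber (n * k) H : ℝ) < 12 * (n : ℝ) ^ 2 * Real.log n →
      12 * (n : ℝ) ^ 2 * Real.log n ≤ SimpleGraph.extremalNumber (n * (k + 1)) H →
        (splitNumber n H : ℝ) ≤ (1 + ε) * (k + 1 : ℕ) := by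
  filter_upwards [
    (Real.tendsto_log_atTop.comp tendsto_natCast_atTop_atTop).eventually_ge_atTop 2,
    tendsto_natCast_atTop_atTop.eventually (eventually_le_and_mul_exp_neg_mul_lt_half
      (b := b) (by linarith) hb hM (c := ε ^ 2 / 4) (by positivity) 2),
    eventually_mul_mul_div_rpow_le (K := 12 * (18 * M)) (L := 3 * (18 * M)) (A := 12) hC
      (by positivity) (by positivity) hb1 hb ha hlow] with n hlog hgrow hdom k hlt hle
  rw [Function.comp_apply] at hlog
  have hn' : (0 : ℝ) < n := Nat.cast_pos.2 (pos_of_log_natCast_pos (two_pos.trans_le hlog))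
  obtain ⟨hk2, hchernoff⟩ := hgrow (k + 1 : ℕ) (Nat.cast_nonneg _) <| calc
    (n : ℝ) ^ 2 ≤ 12 * (n : ℝ) ^ 2 * Real.log n := by nlinarith [pow_pos hn' 2]
    _ ≤ M * (n * (k + 1 : ℕ)) ^ b := by exact_mod_cast hle.trans (hup _)
  have hk1 : 1 ≤ k := by
    have : 2 ≤ k + 1 := by exact_mod_cast hk2
    omega
  refine splitNumber_le_of_le_extremalNumber hH hM.le hb1 hb hup hlog k.succ_pos hε.le hε1
    hchernoff hle ?_
  have hN := hdom (n * k) (n * (k + 1)) (Nat.le_mul_of_pos_right n hk1)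
    (Nat.le_mul_of_pos_right n k.succ_pos) (by nlinarith) (by linarith)
  rw [Nat.cast_mul] at hN
  have hquot : 18 * M * (n * (k + 1 : ℕ)) / (n / 3 : ℝ)
      = 3 * (18 * M) * (n * (k + 1 : ℕ) / n) := by field_simp
  rw [hquot]
  linarith

theorem splitNumber_le_of_forall_lt_of_le {W : Type*} {H : SimpleGraph W} {n : ℕ} {T c : ℝ}
    (hT : 0 < T) (hc : 0 ≤ c)
    (h : ∀ k : ℕ, (SimpleGraph.extremalNumber (n * k) H : ℝ) < T →
      T ≤ SimpleGraph.extremalNumber (n * (k + 1)) H → (splitNumber n H : ℝ) ≤ c * (k + 1 : ℕ))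
    {k : ℕ} (hk : T ≤ SimpleGraph.extremalNumber (n * k) H) :
    (splitNumber n H : ℝ) ≤ c * k := by
  induction k with
  | zero =>
    rw [mul_zero, extremalNumber_zero, Nat.cast_zero] at hk
    exact absurd hk hT.not_ge
  | succ k ih =>
    rcases lt_or_ge (SimpleGraph.extremalNumber (n * k) H : ℝ) T with hlt | hge
    · exact h k hlt hk
    · exact (ih hge).trans (by gcongr; exact k.le_succ)

theorem theorem1_general {W : Type*} [Fintype W] (H : SimpleGraph W) (hforest : ¬ H.IsAcyclic)
    (a b C C' : ℝ) (hC : 0 < C) (hC' : 0 < C') (hb : b < 2)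
    (hex : ∀ᶠ l : ℕ in atTop,
      C * (l : ℝ) ^ a ≤ (SimpleGraph.extremalNumber l H : ℝ) ∧
      (SimpleGraph.extremalNumber l H : ℝ) ≤ C' * (l : ℝ) ^ b)
    (ha : 2 / (3 - b) < a) :
    (∀ ε : ℝ, 0 < ε → ∀ᶠ n : ℕ in atTop, ∀ k : ℕ,
      12 * (n : ℝ) ^ 2 * Real.log n ≤ (SimpleGraph.extremalNumber (n * k) H : ℝ) →
        (splitNumber n H : ℝ) ≤ k + ε * k) ∧
    (∀ n k : ℕ, Fintype.card W ≤ n →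
      SimpleGraph.extremalNumber (n * k) H < n.choose 2 →
        k ≤ splitNumber n H) := by
  refine ⟨fun ε hε ↦ ?_, fun n k ↦ le_splitNumber hforest⟩
  have hH : H ≠ ⊥ := fun h ↦ hforest (h ▸ SimpleGraph.isAcyclic_bot)
  have hle : a ≤ b := exponent_le_of_eventually hC (hex.mono fun l h ↦ h.1.trans h.2)
  have hb1 : 1 < b := one_lt_of_two_div_three_sub_lt hle hb ha
  obtain ⟨M, hM, hup⟩ := exists_forall_le_mul_rpow
    (F := fun l ↦ (SimpleGraph.extremalNumber l H : ℝ)) (fun l ↦ Nat.cast_nonneg _)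
    (by rw [extremalNumber_zero, Nat.cast_zero]) (by linarith) hC' (hex.mono fun l h ↦ h.2)
  filter_upwards [eventually_gt_atTop 1, eventually_splitNumber_le_of_lt_of_le hH hC hM hb1 hb ha
    (hex.mono fun l h ↦ h.1) hup (lt_min hε one_pos) (min_le_right ε 1)] with n hn hsplit k hk
  have hT : 0 < 12 * (n : ℝ) ^ 2 * Real.log n := by
    have : 0 < Real.log n := Real.log_pos (by exact_mod_cast hn)
    positivity
  calc (splitNumber n H : ℝ) ≤ (1 + min ε 1) * k :=
        splitNumber_le_of_forall_lt_of_le hT (by positivity) hsplit hk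
    _ ≤ (1 + ε) * k := by gcongr; exact min_le_left ε 1
    _ = k + ε * k := by ring

theorem theorem1 {W : Type*} [Fintype W] (H : SimpleGraph W)
    (hbip : H.IsBipartite) (hforest : ¬ H.IsAcyclic)
    (a b C C' : ℝ) (hC : 0 < C) (hC' : 0 < C') (hb : b < 2)
    (hex : ∀ᶠ l : ℕ in atTop,
      C * (l : ℝ) ^ a ≤ (SimpleGraph.extremalNumber l H : ℝ) ∧
      (SimpleGraph.extremalNumber l H : ℝ) ≤ C' * (l : ℝ) ^ b)
    (hab : b - a < (2 - b) * (b - 1) / (5 - b)) :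
    -- `f(n,H) ≤ k + o(k)` as `n → ∞`, uniformly over all admissible `k`
    (∀ ε : ℝ, 0 < ε → ∀ᶠ n : ℕ in atTop, ∀ k : ℕ,
      12 * (n : ℝ) ^ 2 * Real.log n ≤ (SimpleGraph.extremalNumber (n * k) H : ℝ) →
        (splitNumber n H : ℝ) ≤ k + ε * k) ∧
    (∀ n k : ℕ, Fintype.card W ≤ n →
      SimpleGraph.extremalNumber (n * k) H < n.choose 2 →
        k ≤ splitNumber n H) :=
  theorem1_general H hforest a b C C' hC hC' hb hex <| two_div_three_sub_lt
    (exponent_le_of_eventually hC (hex.mono fun _ h ↦ h.1.trans h.2)) hb hab
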